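/- Let $\mathcal P$ be a filtered poset, i.e. a poset admitting a strictly order-preserving map $\mathcal P\to\mathbb N$, regarded as a category with one arrow $p\to q$ whenever $p\le q$. For $p\in\mathcal P$ let the degree $d(p)$ be the maximal $n$ for which there is a chain $p_0<p_1<\dots<p_n=p$ in $\mathcal P$. A filtered poset is called a tree if its Hasse diagram contains no undirected cycle (it need not be connected). A wide subposet of $\mathcal P$ is a partial order on the set of elements of $\mathcal P$ that is contained in the order of $\mathcal P$; a maximal tree of $\mathcal P$ is a wide subposet that is a tree and is not strictly contained in any other subposet of $\mathcal P$ that is a tree. Let $\mathcal T$ be a maximal tree of $\mathcal P$, and put \[ D(\mathcal P,\mathcal T)=\{d(q)\mid p\to q \text{ is an arrow of } \mathcal P \text{ that is not an arrow of } \mathcal T\}. \] Let $R$ be a unital commutative ring. For a functor $F\colon \mathcal P^{\mathrm{op}}\to R\text{-Mod}$ let $H^k(\mathcal P;F)=R^k\lim(F)$, where $R^k\lim$ is the $k$-th right derived functor of $\lim\colon \mathrm{Fun}(\mathcal P^{\mathrm{op}},R\text{-Mod})\to R\text{-Mod}$. Then, for every functor $F\colon \mathcal P^{\mathrm{op}}\to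 R\text{-Mod}$, \[ H^k(\mathcal P;F)=0\qquad\text{for every } k>2\cdot\#D(\mathcal P,\mathcal T)+1 . \] The same holds with $D(\mathcal P,\mathcal T)$ replaced by its subset consisting of the degrees $d(q)$ of the targets of those edges $p\to q$ of the Hasse diagram of $\mathcal P$ (i.e. $p<q$ with no element strictly between) that are not in $\mathcal T$. (If the set in question is infinite, the bound is $\infty$ and nothing is claimed.) -/

import Mathlib

open CategoryTheory CategoryTheory.Limits Opposite

universe u v w

/-! ### Filtered posets, degrees, trees -/

/-- A poset is filtered if it admits a strictly order-preserving map to `ℕ`. -/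
def IsFilteredPoset (P : Type u) [PartialOrder P] : Prop :=
  ∃ d : P → ℕ, StrictMono d

/-- The degree of `p`: the maximal length `n` of a chain `p₀ < p₁ < ⋯ < pₙ = p` ending in `p`.
It is finite when `P` is filtered. -/
noncomputable def posetDegree {P : Type u} [PartialOrder P] (p : P) : ℕ∞ :=
  Order.height p

/-- A filtered tree: a filtered poset whose Hasse diagram has no undirected cycles
(connectedness is not required). -/
def IsFilteredTree (P : Type u) [PartialOrder P] : Prop :=
  IsFilteredPoset P ∧ (SimpleGraph.hasse P).IsAcyclic

/-- A wide subposet of `P`: a partial order on the same elements, contained in that of `P`. -/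
@[ext]
structure WideSubposet (P : Type u) [PartialOrder P] where
  /-- The order relation of the subposet. -/
  le : P → P → Prop
  refl : ∀ p, le p p
  trans : ∀ p q r, le p q → le q r → le p r
  le_of_le : ∀ p q, le p q → p ≤ q

namespace WideSubposet

variable {P : Type u} [PartialOrder P]

/-- The partial order of a wide subposet, on the elements of `P`. -/
abbrev toPartialOrder (T : WideSubposet P) : PartialOrder P where
  le := T.le
  lt p q := T.le p q ∧ ¬ T.le q p
  le_refl := T.refl
  le_trans := T.trans
  le_antisymm p q h h' := le_antisymm (T.le_of_le p q h) (T.le_of_le q p h')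

/-- Wide subposets are ordered by inclusion. -/
instance : PartialOrder (WideSubposet P) where
  le T T' := ∀ p q, T.le p q → T'.le p q
  le_refl _ _ _ h := h
  le_trans _ _ _ h h' p q hpq := h' p q (h p q hpq)
  le_antisymm T T' h h' := by
    ext p q
    exact ⟨h p q, h' p q⟩

/-- The wide subposet, with its own order, is a filtered tree. -/
def IsTree (T : WideSubposet P) : Prop :=
  @IsFilteredTree P T.toPartialOrder

/-- A maximal tree of `P`: a wide subposet that is a tree, such that no strictly larger
subposet of `P` is a tree. -/
def IsMaximalTree (T : WideSubposet P) : Prop :=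
  T.IsTree ∧ ∀ T' : WideSubposet P, T < T' → ¬ T'.IsTree

/-- The degrees (in `P`) of the targets of the arrows `p → q` of the category `P`
(that is, `p ≤ q`) which are not arrows of `T`. -/
def missingDegrees (T : WideSubposet P) : Set ℕ∞ :=
  {n | ∃ p q : P, p ≤ q ∧ ¬ T.le p q ∧ posetDegree q = n}

/-- The same set, with the arrows `p → q` of the Hasse diagram of `P` only. -/
def missingHasseDegrees (T : WideSubposet P) : Set ℕ∞ :=
  {n | ∃ p q : P, p ⋖ q ∧ ¬ T.le p q ∧ posetDegree q = n}

end WideSubposet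

/-! ### Higher limits -/

section HigherLimits

/-- Functor categories with small source, with values in an abelian category with small limits
and enough injectives, have enough injectives. -/
theorem functor_enoughInjectives {J : Type u} [Category.{u} J] {C : Type v} [Category.{w} C]
    [Abelian C] [HasLimitsOfSize.{u, u} C] [EnoughInjectives C] :
    EnoughInjectives (J ⥤ C) := by
  have hD : EnoughInjectives (Discrete J ⥤ C) := by
    refine ⟨fun F => ⟨⟨Discrete.functor fun j => Injective.under (F.obj ⟨j⟩), ⟨fun {X Y} g f hf => ?_⟩,
      Discrete.natTrans fun j => Injective.ι (F.obj j), ?_⟩⟩⟩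
    · refine ⟨Discrete.natTrans fun j => Injective.factorThru (J := Injective.under (F.obj j)) (g.app j) (f.app j), ?_⟩
      ext j
      simp
    · have : ∀ j, Mono ((Discrete.natTrans (F := F) (G := Discrete.functor fun j => Injective.under (F.obj ⟨j⟩)) fun j => Injective.ι (F.obj j)).app j) := by
        intro j; dsimp; infer_instance
      exact NatTrans.mono_of_mono_app _
  let L : Discrete J ⥤ J := Discrete.functor id
  have : ((Functor.whiskeringLeft _ _ C).obj L).PreservesMonomorphisms :=
    ⟨fun f hf => by
      have : ∀ j, Mono ((((Functor.whiskeringLeft _ _ C).obj L).map f).app j) := by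
        intro j; dsimp; infer_instance
      exact NatTrans.mono_of_mono_app _⟩
  have : ((Functor.whiskeringLeft _ _ C).obj L).ReflectsMonomorphisms :=
    ⟨fun f hf => by
      have : ∀ j, Mono (f.app j) := fun j =>
        inferInstanceAs (Mono ((((Functor.whiskeringLeft _ _ C).obj L).map f).app ⟨j⟩))
      exact NatTrans.mono_of_mono_app _⟩
  exact EnoughInjectives.of_adjunction (L.ranAdjunction C)

/-- The limit functor is additive. -/
theorem lim_additive {J : Type u} [Category.{u} J] {C : Type v} [Category.{w} C]
    [Preadditive C] [HasLimitsOfShape J C] : (lim : (J ⥤ C) ⥤ C).Additive where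
  map_add := by
    intros
    apply limit.hom_ext
    simp

variable (P : Type u) [PartialOrder P] (R : Type v) [CommRing R]

instance presheaf_enoughInjectives : EnoughInjectives (Pᵒᵖ ⥤ ModuleCat.{max u v} R) :=
  functor_enoughInjectives

instance presheaf_lim_additive :
    (lim : (Pᵒᵖ ⥤ ModuleCat.{max u v} R) ⥤ ModuleCat.{max u v} R).Additive :=
  lim_additive

variable {P R}

/-- The higher limits `Hᵏ(P; F)`: the `k`-th right derived functor of
`lim : Fun(Pᵒᵖ, R-Mod) ⥤ R-Mod`, applied to `F`. -/
noncomputable def higherLimit (k : ℕ) (F : Pᵒᵖ ⥤ ModuleCat.{max u v} R) :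
    ModuleCat.{max u v} R :=
  ((lim : (Pᵒᵖ ⥤ ModuleCat.{max u v} R) ⥤ ModuleCat.{max u v} R).rightDerived k).obj F

end HigherLimits

/-! ### Complexes of presheaves of abelian groups on a poset -/

/-! An injective resolution of `F` is exact at every element in positive degrees and flasque, and
its global sections compute the higher limits. The claim thus becomes exactness of sections over
lower sets, proved in degrees `≥ 2 * m + 2` when at most `m` degrees are bad, i.e. are degrees of
targets of Hasse edges outside the forest (`acyclicOn_of_card_le`).

The induction on `m` removes the largest bad degree `d`; each removal costs two cohomological
degrees (`acyclicOn_of_forall_lt`). The first is spent building a primitive element by element: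
extending it from `Iio q` to the cone `Iic q` shifts the degree by one. The second is spent on `Iio
q` when `q` has degree above `d`: this is the union of the cones under the elements covered by `q`,
and two of these cones meet only in degrees `< d`, since a higher common element would close a cycle
in the forest (`eq_of_le_of_covBy_of_isAcyclic`). Relative to its part of degree `< d`, `Iio q`
therefore splits into separate cones, and that part falls under the induction hypothesis. -/

/-- A cochain complex of presheaves of abelian groups on `P`. -/
structure PosetComplex (P : Type u) [Preorder P] where
  /-- The group of `n`-cochains at `p`. -/
  X : ℕ → P → Type w
  [grp : ∀ n p, AddCommGroup (X n p)]
  /-- The restriction maps. -/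
  res : ∀ (n : ℕ) {p q : P}, p ≤ q → X n q →+ X n p
  /-- The differentials. -/
  d : ∀ (n : ℕ) (p : P), X n p →+ X (n + 1) p
  res_res : ∀ (n : ℕ) {p q r : P} (h : p ≤ q) (h' : q ≤ r) (x : X n r),
    res n h (res n h' x) = res n (h.trans h') x
  res_d : ∀ (n : ℕ) {p q : P} (h : p ≤ q) (x : X n q),
    res (n + 1) h (d n q x) = d n p (res n h x)
  d_d : ∀ (n : ℕ) (p : P) (x : X n p), d (n + 1) p (d n p x) = 0

namespace PosetComplex

attribute [instance] grp

/-! ### Sections over lower sets: exactness, extension and gluing -/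

section Preorder

variable {P : Type u} [Preorder P] (K : PosetComplex.{u, w} P)

/-- The family `t` restricts to a section over `A`. -/
def IsSection {n : ℕ} (A : Set P) (t : ∀ p, K.X n p) : Prop :=
  ∀ ⦃p q : P⦄ (h : p ≤ q), q ∈ A → K.res n h (t q) = t p

/-- The complex of sections over `A` is exact in degree `k`. -/
def AcyclicOn (A : Set P) : ℕ → Prop
  | 0 => ∀ s : ∀ p, K.X 0 p, K.IsSection A s → (∀ p ∈ A, K.d 0 p (s p) = 0) → ∀ p ∈ A, s p = 0
  | k + 1 => ∀ s : ∀ p, K.X (k + 1) p, K.IsSection A s → (∀ p ∈ A, K.d (k + 1) p (s p) = 0) →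
      ∃ t : ∀ p, K.X k p, K.IsSection A t ∧ ∀ p ∈ A, K.d k p (t p) = s p

/-- The complex of sections over `A` vanishing on `B` is exact in degree `k + 1`. -/
def RelAcyclicOn (A B : Set P) (k : ℕ) : Prop :=
  ∀ s : ∀ p, K.X (k + 1) p, K.IsSection A s → (∀ p ∈ A, K.d (k + 1) p (s p) = 0) →
    (∀ p ∈ B, s p = 0) →
    ∃ t : ∀ p, K.X k p, K.IsSection A t ∧ (∀ p ∈ A, K.d k p (t p) = s p) ∧ ∀ p ∈ B, t p = 0

/-- Every section over a lower set extends to a global one. -/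
def IsFlasque : Prop :=
  ∀ (n : ℕ) (B : Set P), IsLowerSet B → ∀ t : ∀ p, K.X n p, K.IsSection B t →
    ∃ t' : ∀ p, K.X n p, K.IsSection Set.univ t' ∧ ∀ p ∈ B, t' p = t p

/-- The complex is exact in positive degrees at every element. -/
def IsPointwiseExact : Prop :=
  ∀ (n : ℕ) (p : P) (x : K.X (n + 1) p), K.d (n + 1) p x = 0 → ∃ y, K.d n p y = x

variable {K} {n k : ℕ} {A B : Set P}

lemma IsSection.mono {t : ∀ p, K.X n p} (h : K.IsSection A t) (hB : B ⊆ A) : K.IsSection B t :=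
  fun _ _ hpq hq => h hpq (hB hq)

lemma IsSection.add {t t' : ∀ p, K.X n p} (h : K.IsSection A t) (h' : K.IsSection A t') :
    K.IsSection A (fun p => t p + t' p) := fun p q hpq hq => by
  rw [map_add, h hpq hq, h' hpq hq]

lemma IsSection.sub {t t' : ∀ p, K.X n p} (h : K.IsSection A t) (h' : K.IsSection A t') :
    K.IsSection A (fun p => t p - t' p) := fun p q hpq hq => by
  rw [map_sub, h hpq hq, h' hpq hq]

lemma IsSection.d {t : ∀ p, K.X n p} (h : K.IsSection A t) :
    K.IsSection A (fun p => K.d n p (t p)) := fun p q hpq hq => by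
  rw [K.res_d, h hpq hq]

lemma acyclicOn_empty : ∀ k, K.AcyclicOn (∅ : Set P) k
  | 0 => fun _ _ _ _ hp => hp.elim
  | _ + 1 => fun _ _ _ => ⟨fun _ => 0, fun _ _ _ hq => hq.elim, fun _ hp => hp.elim⟩

/-- A cone has a top element, so its sections are the values at `q`. -/
lemma IsPointwiseExact.acyclicOn_Iic (hK : K.IsPointwiseExact) (q : P) (k : ℕ) :
    K.AcyclicOn (Set.Iic q) (k + 1) := by
  classical
  intro s hs hd
  obtain ⟨y, hy⟩ := hK k q (s q) (hd q le_rfl)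
  refine ⟨fun p => if h : p ≤ q then K.res k h y else 0, fun a b hab hb => ?_, fun p hp => ?_⟩
  · simp only [dif_pos (show b ≤ q from hb), dif_pos (hab.trans (show b ≤ q from hb)), K.res_res]
  · simp only [dif_pos (show p ≤ q from hp), ← K.res_d, hy, hs (show p ≤ q from hp) le_rfl]

/-- The portion `Hᵏ(B) → Hᵏ⁺¹(A, B) → Hᵏ⁺¹(A)` of the long exact sequence of a pair. A primitive
over `A` is a cocycle on `B`; subtracting the differential of an extended primitive makes it vanish
there. -/
lemma IsFlasque.relAcyclicOn (hK : K.IsFlasque) (hB : IsLowerSet B) (hBA : B ⊆ A)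
    (hA : K.AcyclicOn A (k + 1)) (hBk : K.AcyclicOn B k) : K.RelAcyclicOn A B k := by
  intro s hs hd h0
  obtain ⟨t, ht, hts⟩ := hA s hs hd
  have hdt : ∀ p ∈ B, K.d k p (t p) = 0 := fun p hp => by rw [hts p (hBA hp), h0 p hp]
  cases k with
  -- In degree `0` exactness means that cocycles vanish, so no correction is needed.
  | zero => exact ⟨t, ht, hts, hBk t (ht.mono hBA) hdt⟩
  | succ k =>
    obtain ⟨w, hw, hwt⟩ := hBk t (ht.mono hBA) hdt
    obtain ⟨w', hw', hww'⟩ := hK k B hB w hw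
    refine ⟨fun p => t p - K.d k p (w' p), ht.sub (hw'.mono (Set.subset_univ _)).d,
      fun p hp => ?_, fun p hp => ?_⟩
    · rw [map_sub, K.d_d, sub_zero, hts p hp]
    · simp only [hww' p hp, hwt p hp, sub_self]

/-- Any extension of `t` has an error vanishing on `B`, which a relative primitive corrects. -/
lemma IsFlasque.exists_extend (hK : K.IsFlasque) (hB : IsLowerSet B)
    (hrel : K.RelAcyclicOn A B k) {s : ∀ p, K.X (k + 1) p} (hs : K.IsSection A s)
    (hd : ∀ p ∈ A, K.d (k + 1) p (s p) = 0) {t : ∀ p, K.X k p} (ht : K.IsSection B t)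
    (hts : ∀ p ∈ B, K.d k p (t p) = s p) :
    ∃ t' : ∀ p, K.X k p, K.IsSection A t' ∧ (∀ p ∈ A, K.d k p (t' p) = s p) ∧
      ∀ p ∈ B, t' p = t p := by
  obtain ⟨e, he, het⟩ := hK k B hB t ht
  have heA := he.mono (Set.subset_univ A)
  obtain ⟨w, hw, hws, hw0⟩ := hrel (fun p => s p - K.d k p (e p)) (hs.sub heA.d)
    (fun p hp => by rw [map_sub, K.d_d, sub_zero, hd p hp])
    (fun p hp => by rw [het p hp, hts p hp, sub_self])
  refine ⟨fun p => e p + w p, heA.add hw, fun p hp => ?_, fun p hp => ?_⟩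
  · rw [map_add, hws p hp, add_sub_cancel]
  · simp only [hw0 p hp, het p hp, add_zero]

lemma IsFlasque.acyclicOn_of_rel (hK : K.IsFlasque) (hB : IsLowerSet B) (hBA : B ⊆ A)
    (hrel : K.RelAcyclicOn A B k) (hBk : K.AcyclicOn B (k + 1)) : K.AcyclicOn A (k + 1) := by
  intro s hs hd
  obtain ⟨t, ht, hts⟩ := hBk s (hs.mono hBA) fun p hp => hd p (hBA hp)
  obtain ⟨t', ht', hts', -⟩ := hK.exists_extend hB hrel hs hd ht hts
  exact ⟨t', ht', hts'⟩

/-- The cones `Iic r` overlap only inside `B`, where relative primitives are zero, so the primitives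
chosen on the cones glue. -/
lemma relAcyclicOn_of_cover (hB : IsLowerSet B) (Q : Set P)
    (hcover : ∀ p ∈ A, p ∉ B → ∃ r ∈ Q, p ≤ r) (hQ : ∀ r ∈ Q, Set.Iic r ⊆ A)
    (hdisj : ∀ r ∈ Q, ∀ r' ∈ Q, ∀ p, p ≤ r → p ≤ r' → p ∉ B → r = r')
    (hrel : ∀ r ∈ Q, K.RelAcyclicOn (Set.Iic r) (Set.Iic r ∩ B) k) : K.RelAcyclicOn A B k := by
  classical
  intro s hs hd h0
  have := fun r (hr : r ∈ Q) => hrel r hr s (hs.mono (hQ r hr)) (fun p hp => hd p (hQ r hr hp))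
    (fun p hp => h0 p hp.2)
  choose t ht hts ht0 using this
  choose! c hcQ hc using hcover
  have hval : ∀ p (h : p ∈ A ∧ p ∉ B) r (hr : r ∈ Q), p ≤ r →
      t (c p) (hcQ p h.1 h.2) p = t r hr p := by
    intro p h r hr hpr
    have := hdisj _ (hcQ p h.1 h.2) r hr p (hc p h.1 h.2) hpr h.2
    subst this
    rfl
  refine ⟨fun p => if h : p ∈ A ∧ p ∉ B then t (c p) (hcQ p h.1 h.2) p else 0,
    fun p q hpq hq => ?_, fun p hp => ?_, fun p hp => ?_⟩
  · by_cases hqB : q ∈ B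
    · have hpB := hB hpq hqB
      simp [hqB, hpB]
    · have hcq := hc q hq hqB
      have hcqQ := hcQ q hq hqB
      simp only [dif_pos (And.intro hq hqB)]
      rw [ht _ hcqQ hpq hcq]
      split_ifs with h
      · exact (hval p h _ hcqQ (hpq.trans hcq)).symm
      · have hpA : p ∈ A := hQ _ hcqQ (hpq.trans hcq)
        exact ht0 _ hcqQ p ⟨hpq.trans hcq, by tauto⟩
  · by_cases hpB : p ∈ B
    · simp [hpB, h0 p hpB]
    · simp only [dif_pos (And.intro hp hpB)]
      exact hts _ _ p (hc p hp hpB)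
  · simp [hp]

end Preorder

/-! ### Induction on degrees and the role of the forest -/

section PartialOrder

variable {P : Type u} [PartialOrder P] {K : PosetComplex.{u, w} P} {k : ℕ} {A : Set P}

/-- A primitive is built on the elements of degree `< n` for growing `n`. Distinct elements of
degree `n` are incomparable, so each is attached independently, by extending from `Iio q` to `Iic
q`. -/
lemma IsFlasque.acyclicOn_of_forall_rel (hK : K.IsFlasque) {deg : P → ℕ} (hdeg : StrictMono deg)
    (hA : IsLowerSet A) (hrel : ∀ q ∈ A, K.RelAcyclicOn (Set.Iic q) (Set.Iio q) k) :
    K.AcyclicOn A (k + 1) := by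
  classical
  intro s hs hd
  let Inv : ℕ → (∀ p, K.X k p) → Prop := fun n t =>
    K.IsSection {p | p ∈ A ∧ deg p < n} t ∧ ∀ p ∈ A, deg p < n → K.d k p (t p) = s p
  have step : ∀ n t, Inv n t → ∃ t', Inv (n + 1) t' ∧ ∀ p, deg p < n → t' p = t p := by
    intro n t ht
    have hsub : ∀ q ∈ A, Set.Iic q ⊆ A := fun q hq p hp => hA hp hq
    have hlt : ∀ q, deg q = n → ∀ p, p < q → deg p < n := fun q hq p hp => hq ▸ hdeg hp
    have := fun q (h : q ∈ A ∧ deg q = n) => hK.exists_extend (isLowerSet_Iio q)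
      (hrel q h.1) (hs.mono (hsub q h.1))
      (fun p hp => hd p (hsub q h.1 hp))
      (ht.1.mono fun p hp => ⟨hsub q h.1 (le_of_lt hp), hlt q h.2 p hp⟩)
      (fun p hp => ht.2 p (hsub q h.1 (le_of_lt hp)) (hlt q h.2 p hp))
    choose e he hes het using this
    have hold : ∀ p, deg p < n → ¬ (p ∈ A ∧ deg p = n) := fun p hp h => by omega
    refine ⟨fun p => if h : p ∈ A ∧ deg p = n then e p h p else t p, ⟨fun p q hpq hq => ?_,
      fun p hp hpn => ?_⟩, fun p hp => dif_neg (hold p hp)⟩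
    · rcases hpq.eq_or_lt with rfl | hlt'
      · by_cases h : p ∈ A ∧ deg p = n
        · simp only [dif_pos h]
          exact he p h le_rfl le_rfl
        · simp only [dif_neg h]
          exact ht.1 le_rfl ⟨hq.1, by have := hq.2; have := not_and.mp h hq.1; omega⟩
      · have hpn : deg p < n := by have := hdeg hlt'; have := hq.2; omega
        simp only [dif_neg (hold p hpn)]
        by_cases h : q ∈ A ∧ deg q = n
        · simp only [dif_pos h]
          rw [he q h hpq le_rfl, het q h p hlt']
        · simp only [dif_neg h]
          exact ht.1 hpq ⟨hq.1, by have := hq.2; have := not_and.mp h hq.1; omega⟩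
    · by_cases h : p ∈ A ∧ deg p = n
      · simp only [dif_pos h]
        exact hes p h p le_rfl
      · simp only [dif_neg h]
        exact ht.2 p hp (by have := not_and.mp h hp; omega)
  choose! next hnext hagree using step
  let g : (n : ℕ) → {t // Inv n t} := fun n => Nat.rec
    ⟨fun _ => 0, fun p q _ hq => absurd hq.2 (Nat.not_lt_zero _),
      fun p _ hp => absurd hp (Nat.not_lt_zero _)⟩
    (fun n t => ⟨next n t.1, hnext n t.1 t.2⟩) n
  have hg : ∀ n p, deg p < n → (g (n + 1)).1 p = (g n).1 p := fun n p hp =>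
    hagree n (g n).1 (g n).2 p hp
  have hg' : ∀ n p, deg p < n → (g n).1 p = (g (deg p + 1)).1 p := by
    intro n p hp
    induction n, hp using Nat.le_induction with
    | base => rfl
    | succ n hn ih => rw [hg n p hn, ih]
  -- Stage `deg p + 1` is the first that covers `p`; by `hg'` later stages agree with it.
  refine ⟨fun p => (g (deg p + 1)).1 p, fun p q hpq hq => ?_, fun p hp => ?_⟩
  · have hle := hdeg.monotone hpq
    rw [(g (deg q + 1)).2.1 hpq ⟨hq, Nat.lt_succ_self _⟩, hg' _ p (by omega)]
  · exact (g (deg p + 1)).2.2 p hp (Nat.lt_succ_self _)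

lemma exists_le_covBy_of_strictMono_nat {deg : P → ℕ} (hdeg : StrictMono deg) {x q : P}
    (h : x < q) : ∃ c, x ≤ c ∧ c ⋖ q := by
  induction hn : deg q - deg x using Nat.strong_induction_on generalizing x with
  | _ n ih =>
    by_cases hc : x ⋖ q
    · exact ⟨x, le_rfl, hc⟩
    · obtain ⟨y, hxy, hyq⟩ := (not_covBy_iff h).1 hc
      have h1 := hdeg hxy
      have h2 := hdeg hyq
      obtain ⟨c, hyc, hcq⟩ := ih (deg q - deg y) (by omega) hyq rfl
      exact ⟨c, hxy.le.trans hyc, hcq⟩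

/-- Saturated chains from `x` to `r` and to `r'` use only forest edges and stay strictly below `q`.
Together with the edge from `r'` to `q` they bypass the edge from `r` to `q`, which is a bridge. -/
lemma eq_of_le_of_covBy_of_isAcyclic {deg : P → ℕ} (hdeg : StrictMono deg) {G : SimpleGraph P}
    (hG : G.IsAcyclic) {d : ℕ} (hA : IsLowerSet A)
    (hgood : ∀ q ∈ A, d < deg q → ∀ r, r ⋖ q → G.Adj r q) {q r r' x : P} (hq : q ∈ A)
    (hr : r ⋖ q) (hr' : r' ⋖ q) (hxr : x ≤ r) (hxr' : x ≤ r') (hx : d ≤ deg x) : r = r' := by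
  by_contra hne
  have hdq : d < deg q := hx.trans_lt (hdeg (hxr.trans_lt hr.lt))
  have hbridge := SimpleGraph.isAcyclic_iff_forall_adj_isBridge.1 hG (hgood q hq hdq r hr)
  rw [SimpleGraph.isBridge_iff] at hbridge
  have key : ∀ b, b < q → x ≤ b → (G \ SimpleGraph.fromEdgeSet {s(r, q)}).Reachable x b := by
    intro b
    induction hn : deg b using Nat.strong_induction_on generalizing b with
    | _ n ih =>
      intro hbq hxb
      rcases hxb.eq_or_lt with rfl | hlt
      · rfl
      · obtain ⟨c, hxc, hcb⟩ := exists_le_covBy_of_strictMono_nat hdeg hlt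
        refine (ih (deg c) (hn ▸ hdeg hcb.lt) c rfl (hcb.lt.trans hbq) hxc).trans
          (SimpleGraph.Adj.reachable ?_)
        rw [SimpleGraph.sdiff_adj]
        refine ⟨hgood b (hA hbq.le hq) (hx.trans_lt (hdeg hlt)) c hcb, fun h => ?_⟩
        rcases Sym2.eq_iff.1 ((SimpleGraph.fromEdgeSet_adj _).1 h).1 with ⟨-, h⟩ | ⟨h, -⟩
        · exact hbq.ne h
        · exact (hcb.lt.trans hbq).ne h
  refine hbridge (((key r hr.lt hxr).symm.trans (key r' hr'.lt hxr')).trans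
    (SimpleGraph.Adj.reachable ?_))
  rw [SimpleGraph.sdiff_adj]
  refine ⟨hgood q hq hdq r' hr', fun h => ?_⟩
  rcases Sym2.eq_iff.1 ((SimpleGraph.fromEdgeSet_adj _).1 h).1 with ⟨h, -⟩ | ⟨h, -⟩
  · exact hne h.symm
  · exact hr'.lt.ne h

lemma acyclicOn_of_forall_lt (hK : K.IsFlasque) (hE : K.IsPointwiseExact) {deg : P → ℕ}
    (hdeg : StrictMono deg) {G : SimpleGraph P} (hG : G.IsAcyclic) {c d : ℕ} (hA : IsLowerSet A)
    (hlow : ∀ B ⊆ A, IsLowerSet B → (∀ x ∈ B, deg x < d) → ∀ k, c ≤ k → K.AcyclicOn B k)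
    (hgood : ∀ q ∈ A, d < deg q → ∀ r, r ⋖ q → G.Adj r q) (k : ℕ) (hk : c + 2 ≤ k) :
    K.AcyclicOn A k := by
  obtain ⟨k, rfl⟩ := Nat.exists_eq_add_of_le' (show 2 ≤ k by omega)
  have hsub : ∀ q ∈ A, Set.Iic q ⊆ A := fun q hq p hp => hA hp hq
  refine hK.acyclicOn_of_forall_rel hdeg hA fun q hq => hK.relAcyclicOn (isLowerSet_Iio q)
    Set.Iio_subset_Iic_self (hE.acyclicOn_Iic q _) ?_
  have hlower : IsLowerSet {x | deg x < d} := fun a b hba ha => (hdeg.monotone hba).trans_lt ha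
  -- If `deg q ≤ d`, all of `Iio q` has degree `< d` and `hlow` applies directly. Otherwise it is
  -- treated relative to its part `B` of degree `< d`.
  rcases le_or_gt (deg q) d with hqd | hqd
  · exact hlow _ (Set.Iio_subset_Iic_self.trans (hsub q hq)) (isLowerSet_Iio q)
      (fun x hx => (hdeg hx).trans_le hqd) _ (by omega)
  · set B := Set.Iio q ∩ {x | deg x < d} with hBdef
    have hB : IsLowerSet B := (isLowerSet_Iio q).inter hlower
    have hBA : B ⊆ A := fun x hx => hsub q hq (le_of_lt hx.1)
    refine hK.acyclicOn_of_rel hB Set.inter_subset_left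
      (relAcyclicOn_of_cover hB {r | r ⋖ q} ?_ ?_ ?_ ?_)
      (hlow B hBA hB (fun x hx => hx.2) _ (by omega))
    · intro p hp _
      obtain ⟨r, hpr, hr⟩ := exists_le_covBy_of_strictMono_nat hdeg hp
      exact ⟨r, hr, hpr⟩
    · intro r hr p hp
      exact lt_of_le_of_lt hp hr.lt
    · intro r hr r' hr' p hpr hpr' hpB
      refine eq_of_le_of_covBy_of_isAcyclic hdeg hG hA hgood hq hr hr' hpr hpr' ?_
      by_contra hpd
      exact hpB ⟨hpr.trans_lt hr.lt, not_le.1 hpd⟩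
    · intro r hr
      exact hK.relAcyclicOn ((isLowerSet_Iic r).inter hB) Set.inter_subset_left
        (hE.acyclicOn_Iic r k) (hlow _ (Set.inter_subset_right.trans hBA)
          ((isLowerSet_Iic r).inter hB) (fun x hx => hx.2.2) _ (by omega))

lemma acyclicOn_of_card_le (hK : K.IsFlasque) (hE : K.IsPointwiseExact) {deg : P → ℕ}
    (hdeg : StrictMono deg) {G : SimpleGraph P} (hG : G.IsAcyclic) (m : ℕ) :
    ∀ (A : Set P) (D : Finset ℕ), IsLowerSet A → D.card ≤ m →
      (∀ q ∈ A, deg q ∉ D → ∀ r, r ⋖ q → G.Adj r q) → ∀ k, 2 * m + 2 ≤ k → K.AcyclicOn A k := by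
  induction m with
  | zero =>
    intro A D hA hD hgood k hk
    obtain rfl := Finset.card_eq_zero.1 (Nat.le_zero.1 hD)
    -- With `d = 0` the low part is empty, hence exact from degree `0` on.
    refine acyclicOn_of_forall_lt hK hE hdeg hG (c := 0) (d := 0) hA (fun B _ _ hlt k _ => ?_)
      (fun q hq _ => hgood q hq (Finset.notMem_empty _)) k (by omega)
    obtain rfl : B = ∅ := Set.eq_empty_of_forall_notMem fun x hx => Nat.not_lt_zero _ (hlt x hx)
    exact acyclicOn_empty k
  | succ m ih =>
    intro A D hA hD hgood k hk
    rcases D.eq_empty_or_nonempty with rfl | hne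
    · exact ih A ∅ hA (by simp) hgood k (by omega)
    · refine acyclicOn_of_forall_lt hK hE hdeg hG (c := 2 * m + 2) (d := D.max' hne) hA
        (fun B hBA hB hlt k hk => ?_)
        (fun q hq hlt => hgood q hq fun h => (D.le_max' _ h).not_gt hlt) k (by omega)
      refine ih B (D.erase (D.max' hne)) hB ?_ (fun q hq hqD => hgood q (hBA hq) fun h => hqD ?_)
        k hk
      · rw [Finset.card_erase_of_mem (D.max'_mem hne)]
        omega
      · exact Finset.mem_erase.2 ⟨(hlt q hq).ne, h⟩

end PartialOrder

end PosetComplex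

/-! ### Injective resolutions and higher limits -/

section Presheaf

variable {P : Type u} [PartialOrder P] {R : Type v} [CommRing R]

/-- The underlying complex of presheaves of abelian groups of a cochain complex of presheaves of
modules. -/
def posetComplexOf (I : CochainComplex (Pᵒᵖ ⥤ ModuleCat.{w} R) ℕ) : PosetComplex.{u, w} P where
  X n p := (I.X n).obj (op p)
  res n _ _ h := ((I.X n).map (homOfLE h).op).hom.toAddMonoidHom
  d n p := ((I.d n (n + 1)).app (op p)).hom.toAddMonoidHom
  res_res n p q r h h' x := by
    change ((I.X n).map (homOfLE h).op) ((I.X n).map (homOfLE h').op x) = _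
    rw [← ModuleCat.comp_apply, ← Functor.map_comp]
    rfl
  res_d n p q h x := by
    change (I.X (n + 1)).map (homOfLE h).op ((I.d n (n + 1)).app (op q) x) =
      (I.d n (n + 1)).app (op p) ((I.X n).map (homOfLE h).op x)
    rw [← ModuleCat.comp_apply, ← ModuleCat.comp_apply, (I.d n (n + 1)).naturality]
  d_d n p x := by
    change (I.d (n + 1) (n + 1 + 1)).app (op p) ((I.d n (n + 1)).app (op p) x) = 0
    rw [← ModuleCat.comp_apply, ← NatTrans.comp_app, I.d_comp_d]
    rfl

lemma posetComplexOf_isPointwiseExact {F : Pᵒᵖ ⥤ ModuleCat.{w} R} (I : InjectiveResolution F) :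
    (posetComplexOf I.cocomplex).IsPointwiseExact := by
  intro n p x hx
  have h := (I.exact_succ n).map ((evaluation _ _).obj (op p))
  exact (ShortComplex.moduleCat_exact_iff _).1 h x hx

/-- The presheaf `q ↦ ∏ p ≤ q, F p`. -/
def godement (F : Pᵒᵖ ⥤ ModuleCat.{max u v} R) : Pᵒᵖ ⥤ ModuleCat.{max u v} R where
  obj q := ModuleCat.of R (∀ p : {p : P // p ≤ q.unop}, F.obj (op p.1))
  map {q q'} f := ModuleCat.ofHom
    { toFun := fun x p => x ⟨p.1, p.2.trans (leOfHom f.unop)⟩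
      map_add' := fun _ _ => rfl
      map_smul' := fun _ _ => rfl }

/-- The embedding of a presheaf into its Godement presheaf. -/
def toGodement (F : Pᵒᵖ ⥤ ModuleCat.{max u v} R) : F ⟶ godement F where
  app q := ModuleCat.ofHom (Y := ∀ p : {p : P // p ≤ q.unop}, F.obj (op p.1))
    { toFun := fun x p => F.map (homOfLE p.2).op x
      map_add' := fun _ _ => by ext; simp
      map_smul' := fun _ _ => by ext; simp }
  naturality q q' f := by
    ext x
    funext p
    change F.map (homOfLE p.2).op (F.map f x) =
      F.map (homOfLE (p.2.trans (leOfHom f.unop))).op x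
    rw [← ModuleCat.comp_apply, ← Functor.map_comp]
    rfl

instance (F : Pᵒᵖ ⥤ ModuleCat.{max u v} R) : Mono (toGodement F) := by
  have : ∀ q, Mono ((toGodement F).app q) := fun q => by
    rw [ModuleCat.mono_iff_injective]
    intro x y hxy
    have h : F.map (homOfLE (le_refl q.unop)).op x = F.map (homOfLE (le_refl q.unop)).op y :=
      congrFun hxy (⟨q.unop, le_rfl⟩ : {p : P // p ≤ q.unop})
    rwa [show (homOfLE (le_refl q.unop)).op = 𝟙 q from rfl, F.map_id] at h
  exact NatTrans.mono_of_mono_app _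

/-- An injective presheaf is a retract of its Godement presheaf, in which a section over a lower set
extends by zero. -/
lemma posetComplexOf_isFlasque (I : CochainComplex (Pᵒᵖ ⥤ ModuleCat.{max u v} R) ℕ)
    (hI : ∀ n, Injective (I.X n)) : (posetComplexOf I).IsFlasque := by
  classical
  intro n B hB t ht
  have := hI n
  let π : godement (I.X n) ⟶ I.X n := Injective.factorThru (𝟙 _) (toGodement (I.X n))
  let e : ∀ q : P, (godement (I.X n)).obj (op q) := fun q =>
    (fun p => if p.1 ∈ B then t p.1 else 0 : ∀ p : {p : P // p ≤ q}, (I.X n).obj (op p.1))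
  refine ⟨fun q => π.app (op q) (e q), fun p q h _ => ?_, fun q hq => ?_⟩
  · change (I.X n).map (homOfLE h).op (π.app (op q) (e q)) = π.app (op p) (e p)
    rw [← ModuleCat.comp_apply, ← π.naturality]
    rfl
  · have he : e q = (toGodement (I.X n)).app (op q) (t q) := by
      funext p
      exact (if_pos (hB p.2 hq)).trans (ht p.2 hq).symm
    change π.app (op q) (e q) = t q
    rw [he]
    exact congrArg (fun f : I.X n ⟶ I.X n => f.app (op q) (t q))
      (Injective.comp_factorThru (𝟙 _) (toGodement (I.X n)))

lemma exists_limit_π_eq (G : Pᵒᵖ ⥤ ModuleCat.{max u v} R) (t : ∀ p : P, G.obj (op p))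
    (ht : ∀ (p q : P) (h : p ≤ q), G.map (homOfLE h).op (t q) = t p) :
    ∃ x : (limit G : ModuleCat.{max u v} R), ∀ p, limit.π G (op p) x = t p := by
  let hl := isLimitOfPreserves (forget (ModuleCat.{max u v} R)) (limit.isLimit G)
  let s : (G ⋙ forget _).sections :=
    ⟨fun p => t p.unop, fun {q p} f => ht p.unop q.unop (leOfHom f.unop)⟩
  exact ⟨(Types.isLimitEquivSections hl).symm s, fun p =>
    Types.isLimitEquivSections_symm_apply hl s (op p)⟩

/-- Elements of the limit are the sections over the whole poset. -/
lemma isZero_higherLimit_of_acyclicOn {F : Pᵒᵖ ⥤ ModuleCat.{max u v} R}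
    (I : InjectiveResolution F) {k : ℕ}
    (h : (posetComplexOf I.cocomplex).AcyclicOn Set.univ (k + 1)) :
    IsZero (higherLimit (k + 1) F) := by
  refine IsZero.of_iso ?_ (I.isoRightDerivedObj lim (k + 1))
  change IsZero (HomologicalComplex.homology _ (k + 1))
  rw [← HomologicalComplex.exactAt_iff_isZero_homology,
    HomologicalComplex.exactAt_iff' _ k (k + 1) (k + 1 + 1) (by simp) (by simp),
    ShortComplex.moduleCat_exact_iff]
  intro (x : (limit (I.cocomplex.X (k + 1)) : ModuleCat.{max u v} R))
    (hx : limMap (I.cocomplex.d (k + 1) (k + 1 + 1)) x = 0)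
  obtain ⟨t, ht, htx⟩ := h (fun p => limit.π (I.cocomplex.X (k + 1)) (op p) x)
    (fun p q hpq _ => by
      change (I.cocomplex.X (k + 1)).map (homOfLE hpq).op (limit.π (I.cocomplex.X (k + 1)) (op q) x) = _
      rw [← ModuleCat.comp_apply, limit.w])
    (fun p _ => by
      change (I.cocomplex.d (k + 1) (k + 1 + 1)).app (op p)
        (limit.π (I.cocomplex.X (k + 1)) (op p) x) = 0
      rw [← ModuleCat.comp_apply, ← limMap_π, ModuleCat.comp_apply, hx, map_zero])
  obtain ⟨y, hy⟩ := exists_limit_π_eq (I.cocomplex.X k) t fun p q hpq => ht hpq (Set.mem_univ q)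
  refine ⟨y, ?_⟩
  change limMap (I.cocomplex.d k (k + 1)) y = x
  refine Concrete.limit_ext _ _ _ fun p => ?_
  rw [← ModuleCat.comp_apply, limMap_π, ModuleCat.comp_apply]
  exact (congrArg _ (hy p.unop)).trans (htx p.unop (Set.mem_univ _))

end Presheaf

/-! ### Degrees, Hasse edges and the conclusion -/

lemma IsFilteredPoset.exists_degree {P : Type u} [PartialOrder P] (hP : IsFilteredPoset P) :
    ∃ deg : P → ℕ, StrictMono deg ∧ ∀ p, posetDegree p = deg p := by
  obtain ⟨f, hf⟩ := hP
  have hfin : ∀ p : P, Order.height p ≠ ⊤ := fun p => by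
    have := Order.height_le_height_apply_of_strictMono f hf p
    rw [Order.height_nat] at this
    exact ne_top_of_le_ne_top (ENat.natCast_ne_top _) this
  have hdeg : ∀ p : P, posetDegree p = ((Order.height p).toNat : ℕ∞) := fun p =>
    (ENat.natCast_toNat (hfin p)).symm
  refine ⟨fun p => (Order.height p).toNat, fun p q hpq => ?_, hdeg⟩
  have h := Order.height_strictMono hpq (lt_top_iff_ne_top.2 (hfin p))
  rwa [← ENat.natCast_toNat (hfin p), ← ENat.natCast_toNat (hfin q), Nat.cast_lt] at h

/-- An element strictly between in `T` would be strictly between in `P`. -/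
lemma WideSubposet.hasse_adj_of_covBy {P : Type u} [PartialOrder P] (T : WideSubposet P) {p q : P}
    (h : p ⋖ q) (hT : T.le p q) : (@SimpleGraph.hasse P T.toPartialOrder.toPreorder).Adj p q := by
  have hlt : ∀ a b, T.le a b ∧ ¬ T.le b a → a < b := fun a b hab =>
    lt_of_le_of_ne (T.le_of_le a b hab.1) fun e => hab.2 (e ▸ T.refl a)
  exact Or.inl ⟨⟨hT, fun h' => h.lt.not_ge (T.le_of_le q p h')⟩,
    fun c hpc hcq => h.2 (hlt p c hpc) (hlt c q hcq)⟩

lemma WideSubposet.missingHasseDegrees_subset {P : Type u} [PartialOrder P] (T : WideSubposet P) :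
    T.missingHasseDegrees ⊆ T.missingDegrees := by
  rintro n ⟨p, q, h, hT, hn⟩
  exact ⟨p, q, h.le, hT, hn⟩

/-- Vanishing of higher limits, for an arbitrary tree contained in the poset. -/
theorem WideSubposet.IsTree.isZero_higherLimit {P : Type u} [PartialOrder P]
    (hP : IsFilteredPoset P) {T : WideSubposet P} (hT : T.IsTree) {R : Type v} [CommRing R]
    (F : Pᵒᵖ ⥤ ModuleCat.{max u v} R) (k : ℕ)
    (hk : 2 * T.missingHasseDegrees.encard + 1 < (k : ℕ∞)) : IsZero (higherLimit k F) := by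
  obtain ⟨deg, hdeg, hdeg'⟩ := hP.exists_degree
  have hcard : ((fun n : ℕ => (n : ℕ∞)) ⁻¹' T.missingHasseDegrees).encard ≤
      T.missingHasseDegrees.encard :=
    (Function.Injective.encard_image Nat.cast_injective _).symm.le.trans
      (Set.encard_le_encard (Set.image_preimage_subset _ _))
  have hfin : T.missingHasseDegrees.encard ≠ ⊤ := fun h => by simp [h] at hk
  have hD := Set.encard_ne_top_iff.1 (ne_top_of_le_ne_top hfin hcard)
  rw [hD.encard_eq_coe_toFinset_card] at hcard
  -- The strict bound `2 * #D + 1 < k` is the threshold `2 * m + 2 ≤ k` of the induction.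
  have hm : 2 * hD.toFinset.card + 2 ≤ k := by
    have h : ((2 * hD.toFinset.card + 1 : ℕ) : ℕ∞) < k := by
      push_cast
      exact lt_of_le_of_lt (by gcongr) hk
    exact_mod_cast h
  obtain ⟨k, rfl⟩ := Nat.exists_eq_add_of_le' (show 1 ≤ k by omega)
  let I : InjectiveResolution F := Classical.choice HasInjectiveResolution.out
  refine isZero_higherLimit_of_acyclicOn I (PosetComplex.acyclicOn_of_card_le
    (posetComplexOf_isFlasque _ I.injective) (posetComplexOf_isPointwiseExact I) hdeg hT.2
    hD.toFinset.card Set.univ hD.toFinset isLowerSet_univ le_rfl (fun q _ hq r hr => ?_) _ hm)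
  refine T.hasse_adj_of_covBy hr (by_contra fun h => hq ?_)
  exact hD.mem_toFinset.2 ⟨r, q, hr, h, hdeg' q⟩

theorem mainTheorem6 {P : Type u} [PartialOrder P] (hP : IsFilteredPoset P)
    (T : WideSubposet P) (hT : T.IsMaximalTree)
    {R : Type v} [CommRing R] (F : Pᵒᵖ ⥤ ModuleCat.{max u v} R) :
    (∀ k : ℕ, 2 * T.missingDegrees.encard + 1 < (k : ℕ∞) → IsZero (higherLimit k F)) ∧
    (∀ k : ℕ, 2 * T.missingHasseDegrees.encard + 1 < (k : ℕ∞) → IsZero (higherLimit k F)) := by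
  refine ⟨fun k hk => hT.1.isZero_higherLimit hP F k (lt_of_le_of_lt ?_ hk),
    fun k hk => hT.1.isZero_higherLimit hP F k hk⟩
  gcongr
  exact T.missingHasseDegrees_subset
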